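/- Let $n\ge 1$, $d\ge 2$ and $s\ge 1$ be integers with $$s\le \tfrac12\Big(\tbinom{n+d}{d}+1\Big)-\tbinom{n+d}{d}^{-1}\tbinom{n+2d}{2d}.$$ For $z\in\mathbb R^n$ let $m_d(z)=(z^\alpha)_{|\alpha|\le d}$ be the vector of all monomials of degree at most $d$, its first entry being the monomial $1$. Put $N=\binom{n+d}{d}$ and let $\mathcal C$ be the pseudo-moment cone, i.e. the set of the real symmetric $N\times N$ matrices $M(\ell)=(\ell(x^{\alpha+\beta}))_{|\alpha|=|\beta|=d}$, where $\ell$ runs over the linear functionals on real forms of degree $2d$ in $n+1$ variables with $\ell(q^2)\ge 0$ for every form $q$ of degree $d$; here the rows and columns are identified with the monomials of degree at most $d$ in $n$ variables by setting the first variable to $1$. Consider the following algorithm with input $X\in\mathcal C$, $X\neq 0$. Start with $X_1=X$. While $X_k\ne 0$: let $\mathcal F_k$ be the minimal face of $\mathcal C$ containing $X_k$; draw a random symmetric $N\times N$ matrix $B_k$ whose law is absolutely continuous with respect to Lebesgue measure on the symmetric matrices; choose $M_k\in\operatorname{argmin}\{\operatorname{tr}(B_kY) : Y\in\mathcal F_k,\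 \operatorname{tr}Y=1\}$; set $t_k=\sup\{t\ge 0 : X_k-tM_k\in\mathcal F_k\}$ and $X_{k+1}=X_k-t_kM_k$. Stop when the current matrix is $0$ and return the pairs $(t_k,M_k)$. Then for $((w_i,z_i))_{i=1}^s$ in a Zariski-open dense subset of $(\mathbb R\times\mathbb R^n)^s$ the following holds. Run the algorithm, in exact arithmetic, on $X=\sum_{i=1}^s w_i^2\,m_d(z_i)m_d(z_i)^{\mathsf T}$. Almost surely every step is well defined, the algorithm terminates, and every output $\{(t_k,M_k)\}_{k=1}^r$ satisfies $r=s$ and, after a reordering of the pairs $(w_i,z_i)$, for every $k\in\{1,\dots,s\}$: 1. $t_k=w_k^2\,\|m_d(z_k)\|_2^2$ and $M_k=\|m_d(z_k)\|_2^{-2}\,m_d(z_k)m_d(z_k)^{\mathsf T}$; 2. $M_k$ has rank one and has exactly one nonzero eigenvalue; 3. for every unit eigenvector $h_k$ of $M_k$ for its nonzero eigenvalue, the first entry $h_{k,1}$ is nonzero, $m_d(z_k)=h_k/h_{k,1}$ (so that the $j$-th coordinate of $z_k$ is the entry of $h_k/h_{k,1}$ at the monomial $z_j$, for $j=1,\dots,n$),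 and $w_k^2=t_k\,h_{k,1}^2$. -/

import Mathlib

open MeasureTheory
open scoped Matrix

namespace PseudoMoment

/-! ### Multi-indices and monomial vectors -/

/-- Multi-indices `α ∈ ℕ^m` with `|α| = d`. -/
def MultiIndex (m d : ℕ) : Type := {α : Fin m → ℕ // ∑ i, α i = d}

instance (m d : ℕ) : DecidableEq (MultiIndex m d) :=
  inferInstanceAs (DecidableEq {α : Fin m → ℕ // ∑ i, α i = d})

instance (m d : ℕ) : Fintype (MultiIndex m d) :=
  Fintype.subtype (Finset.piAntidiag (Finset.univ : Finset (Fin m)) d) (by simp)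

/-- The vector `v_d(u) = (u^α)_{|α| = d}` of all monomials of degree `d`. -/
def veroneseVec {m : ℕ} (d : ℕ) (u : Fin m → ℝ) : MultiIndex m d → ℝ :=
  fun α => ∏ i, u i ^ α.1 i

/-- The vector `m_d(z) = v_d([1; z])` of all monomials of degree at most `d` in `z ∈ ℝ^n`. The
monomial `z^β` with `|β| ≤ d` is indexed by the homogeneous multi-index `(d - |β|, β)`. -/
def momentVec {n : ℕ} (d : ℕ) (z : Fin n → ℝ) : MultiIndex (n + 1) d → ℝ :=
  veroneseVec d (Fin.cons 1 z)

/-- The index `(d, 0, …, 0)` of the constant monomial `1`: the first entry of `m_d(z)`. -/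
def constIndex (n d : ℕ) : MultiIndex (n + 1) d := ⟨Pi.single 0 d, by simp⟩

/-- The index `(d - 1, e_j)` of the degree-one monomial `z_j`. -/
def linIndex {n d : ℕ} (hd : 0 < d) (j : Fin n) : MultiIndex (n + 1) d :=
  ⟨Pi.single 0 (d - 1) + Pi.single j.succ 1, by
    simp only [Pi.add_apply, Finset.sum_add_distrib, Finset.sum_pi_single', Finset.mem_univ,
      if_true]
    omega⟩

/-- The rank-one matrix `m_d(z) m_d(z)ᵀ`. -/
def atomMatrix {n : ℕ} (d : ℕ) (z : Fin n → ℝ) :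
    Matrix (MultiIndex (n + 1) d) (MultiIndex (n + 1) d) ℝ :=
  Matrix.vecMulVec (momentVec d z) (momentVec d z)

/-- The squared Euclidean norm of `m_d(z)`. -/
noncomputable def momentNormSq {n : ℕ} (d : ℕ) (z : Fin n → ℝ) : ℝ :=
  ∑ α, momentVec d z α ^ 2

/-! ### The pseudo-moment cone -/

/-- The space of real forms of degree `d` in `m` variables. -/
abbrev Form (m d : ℕ) : Type := MvPolynomial.homogeneousSubmodule (Fin m) ℝ d

/-- The square of a form of degree `d`, as a form of degree `2d`. -/
noncomputable def Form.square {m d : ℕ} (q : Form m d) : Form m (2 * d) :=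
  ⟨(q : MvPolynomial (Fin m) ℝ) ^ 2, by
    have h := (show (q : MvPolynomial (Fin m) ℝ).IsHomogeneous d from q.2).pow 2
    rw [mul_comm] at h
    exact h⟩

/-- The monomial `x^(α+β)` as a form of degree `2d`, where `|α| = |β| = d`. -/
noncomputable def monomialForm {m d : ℕ} (α β : MultiIndex m d) : Form m (2 * d) :=
  ⟨MvPolynomial.monomial (Finsupp.equivFunOnFinite.symm (α.1 + β.1)) 1, by
    refine MvPolynomial.isHomogeneous_monomial 1 ?_
    rw [Finsupp.degree_eq_sum]
    simp [Finset.sum_add_distrib, α.2, β.2, two_mul]⟩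

/-- `Σ_{m,2d}^*`: the linear functionals on forms of degree `2d` that are nonnegative on the
squares of forms of degree `d`. -/
def sosDual (m d : ℕ) : Set (Form m (2 * d) →ₗ[ℝ] ℝ) :=
  {l | ∀ q : Form m d, 0 ≤ l q.square}

/-- The matrix `M(ℓ)_{α,β} = ℓ(x^(α+β))`. -/
noncomputable def functionalMatrix {m d : ℕ} (l : Form m (2 * d) →ₗ[ℝ] ℝ) :
    Matrix (MultiIndex m d) (MultiIndex m d) ℝ :=
  Matrix.of fun α β => l (monomialForm α β)

/-- The matrix realization `{M(ℓ) | ℓ ∈ Σ_{m,2d}^*}` of the pseudo-moment cone. -/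
def pseudoMomentCone (m d : ℕ) : Set (Matrix (MultiIndex m d) (MultiIndex m d) ℝ) :=
  functionalMatrix '' sosDual m d

/-! ### Minimal faces and the extreme ray decomposition algorithm -/

/-- The minimal face of the convex set `C` containing `x`: the intersection of all the faces
(convex extreme subsets) of `C` that contain `x`. -/
def minface {E : Type*} [AddCommGroup E] [Module ℝ E] (x : E) (C : Set E) : Set E :=
  ⋂₀ {F | IsExtreme ℝ C F ∧ Convex ℝ F ∧ x ∈ F}

section Algorithm

variable {ι : Type*} [Fintype ι]

/-- One iteration of the algorithm at the current matrix `X ≠ 0`, with the drawn matrix `B`: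
`M` minimizes `⟨B, Y⟩ = tr (B Y)` over the `Y` of trace one in the minimal face of `X`, and
`t = sup {τ ≥ 0 | X - τ M ∈ minface X}`. The next matrix is `X' = X - t M`. -/
structure RayStep (C : Set (Matrix ι ι ℝ)) (B X M : Matrix ι ι ℝ) (t : ℝ)
    (X' : Matrix ι ι ℝ) : Prop where
  ne_zero : X ≠ 0
  mem_face : M ∈ minface X C
  trace_eq_one : M.trace = 1
  minimal : ∀ Y ∈ minface X C, Y.trace = 1 → (B * M).trace ≤ (B * Y).trace
  step_length : IsLUB {τ : ℝ | 0 ≤ τ ∧ X - τ • M ∈ minface X C} t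
  next_eq : X' = X - t • M

/-- The first `r` iterations of an execution of the algorithm on the cone `C` with input `X₀`,
where `B k` is the matrix drawn in iteration `k` (counted from `0`). -/
structure IsRun (C : Set (Matrix ι ι ℝ)) (B : ℕ → Matrix ι ι ℝ) (X₀ : Matrix ι ι ℝ) (r : ℕ)
    (X : Fin (r + 1) → Matrix ι ι ℝ) (t : Fin r → ℝ) (M : Fin r → Matrix ι ι ℝ) : Prop where
  start : X 0 = X₀
  step : ∀ k : Fin r, RayStep C (B k) (X k.castSucc) (M k) (t k) (X k.succ)

/-- The algorithm returns `{(t k, M k)}` after exactly `r` iterations: the matrix left over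
after `r` iterations is zero. -/
def Returns (C : Set (Matrix ι ι ℝ)) (B : ℕ → Matrix ι ι ℝ) (X₀ : Matrix ι ι ℝ) (r : ℕ)
    (t : Fin r → ℝ) (M : Fin r → Matrix ι ι ℝ) : Prop :=
  ∃ X : Fin (r + 1) → Matrix ι ι ℝ, IsRun C B X₀ r X t M ∧ X (Fin.last r) = 0

/-- Matrices carry the product σ-algebra of their entries. -/
instance : MeasurableSpace (Matrix ι ι ℝ) := inferInstanceAs (MeasurableSpace (ι → ι → ℝ))

/-- Lebesgue measure on the space of real symmetric matrices, with the entries `B_{ij}`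
(`{i, j}` an unordered pair) as coordinates, regarded as a measure on all square matrices that
is carried by the symmetric ones. -/
noncomputable def symLebesgue (ι : Type*) [Fintype ι] : Measure (Matrix ι ι ℝ) :=
  Measure.map (fun c : Sym2 ι → ℝ => Matrix.of fun i j => c s(i, j)) volume

end Algorithm

/-! ### Generic properties of weights and atoms -/

section Generic

variable {n s : ℕ}

/-- The `s (1 + n)` real coordinates of a tuple `((w_i, z_i))_i` in `(ℝ × ℝ^n)^s`. -/
def paramCoords (p : Fin s → ℝ × (Fin n → ℝ)) : Fin s × Option (Fin n) → ℝ :=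
  fun q => q.2.elim (p q.1).1 (p q.1).2

/-- Varieties (Zariski-closed sets) in `(ℝ × ℝ^n)^s`. -/
def IsVariety (S : Set (Fin s → ℝ × (Fin n → ℝ))) : Prop :=
  ∃ F : Finset (MvPolynomial (Fin s × Option (Fin n)) ℝ),
    S = {p | ∀ f ∈ F, MvPolynomial.eval (paramCoords p) f = 0}

/-- `P` holds for generic `((w_i, z_i))_i` in `(ℝ × ℝ^n)^s`: it holds on a Zariski-open set whose
Zariski closure is the whole space. -/
def HoldsGenerically (P : (Fin s → ℝ × (Fin n → ℝ)) → Prop) : Prop :=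
  ∃ A : Set (Fin s → ℝ × (Fin n → ℝ)), IsVariety Aᶜ ∧
    (∀ S, IsVariety S → A ⊆ S → S = Set.univ) ∧ ∀ p ∈ A, P p

end Generic

end PseudoMoment

open PseudoMoment

namespace PseudoMoment

/-! ### Matrices separating a pair of points -/

/-! Write v_i = m_d(z_i). The key claim is that, for generic points, the minimal face of every
partial sum Σ_{i∈T} w_i² v_i v_iᵀ is the simplicial cone on its atoms. Suppose that for each pair a
≠ b there is a symmetric S, orthogonal to all moment matrices, with S v_i = 0 for i ≠ a, b and v_aᵀ
S v_b ≠ 0. A moment matrix M whose quadratic form vanishes on the common orthogonal complement of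
the v_i, i ∈ T, has the form Σ G_ij v_i v_jᵀ, and ⟨S, M⟩ = 0 then reads 2 G_ab v_aᵀ S v_b = 0. So G
is diagonal, with nonnegative entries because M is positive semidefinite
(`mem_atomCone_of_mem_pseudoMomentCone`, `minface_sum_atomMatrix`).

Such S exist by counting: N(N+1)/2 unknown entries face binom(n+2d, 2d) orthogonality equations and
fewer than sN annihilation equations, and the bound on s leaves more unknowns than equations. The
equations do not involve z_a and z_b, so these two points remain free to make the pairing nonzero
(`exists_polynomial_separatesPair`).

On a simplicial face the trace-one slice is a simplex whose vertices are the normalized atoms.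
Almost surely every drawn objective takes distinct values at the atoms, so the minimizer is a
vertex, and the line search removes exactly that atom and leaves a sum of the same kind
(`RayStep.eq_atom`, `IsRun.exists_injective`). Each point is then read off an eigenvector, since
m_d(z) has first entry 1. -/

theorem card_multiIndex (n d : ℕ) : Fintype.card (MultiIndex (n + 1) d) = (n + d).choose d := by
  have h1 : Fintype.card (MultiIndex (n + 1) d) =
      (Finset.piAntidiag (Finset.univ : Finset (Fin (n + 1))) d).card :=
    Fintype.subtype_card _ _
  rw [h1, ← Finset.map_sym_eq_piAntidiag, Finset.card_map, Finset.sym_univ, Finset.card_univ,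
    Sym.card_sym_eq_choose, Fintype.card_fin]
  congr 1
  omega

/-- The multi-index `α + β`. -/
def addIndex {m d : ℕ} (α β : MultiIndex m d) : MultiIndex m (2 * d) :=
  ⟨α.1 + β.1, by simp [Finset.sum_add_distrib, α.2, β.2, two_mul]⟩

/-- The monomial `x^γ` as a form. -/
noncomputable def indexForm {m d : ℕ} (γ : MultiIndex m d) : Form m d :=
  ⟨MvPolynomial.monomial (Finsupp.equivFunOnFinite.symm γ.1) 1, by
    refine MvPolynomial.isHomogeneous_monomial 1 ?_
    rw [Finsupp.degree_eq_sum]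
    exact γ.2⟩

theorem monomialForm_eq {m d : ℕ} (α β : MultiIndex m d) :
    monomialForm α β = indexForm (addIndex α β) := rfl

/-- The value of l at x^(α+β) depends only on α + β, so the sum can be grouped by fibres. This turns
orthogonality to all moment matrices into finitely many linear equations on S, one per monomial of
degree 2d. -/
theorem sum_mul_apply_monomialForm_eq_zero {m d : ℕ} (S : MultiIndex m d → MultiIndex m d → ℝ)
    (hS : ∀ γ, ∑ q : MultiIndex m d × MultiIndex m d with addIndex q.1 q.2 = γ, S q.1 q.2 = 0)
    (l : Form m (2 * d) →ₗ[ℝ] ℝ) : ∑ α, ∑ β, S α β * l (monomialForm α β) = 0 := by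
  rw [← Fintype.sum_prod_type' (fun α β => S α β * l (monomialForm α β)),
    ← Finset.sum_fiberwise _ (fun q : MultiIndex m d × MultiIndex m d => addIndex q.1 q.2)]
  refine Finset.sum_eq_zero fun γ _ => ?_
  rw [Finset.sum_congr rfl (g := fun q => S q.1 q.2 * l (indexForm γ)), ← Finset.sum_mul, hS,
    zero_mul]
  intro q hq
  rw [monomialForm_eq, (Finset.mem_filter.1 hq).2]

/-- The product u · m_d(z) is a polynomial in z with coefficient vector u, and a real polynomial
that vanishes everywhere is zero. Distinct indices give distinct monomials because the exponent of
the homogenizing variable is determined by the others. -/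
theorem eq_zero_of_dotProduct_momentVec {n d : ℕ} (u : MultiIndex (n + 1) d → ℝ)
    (hu : ∀ z : Fin n → ℝ, u ⬝ᵥ momentVec d z = 0) : u = 0 := by
  classical
  let τ : MultiIndex (n + 1) d → (Fin n →₀ ℕ) := fun α =>
    Finsupp.equivFunOnFinite.symm fun j => α.1 j.succ
  have hτ : Function.Injective τ := by
    intro α β h
    have h' : ∀ j : Fin n, α.1 j.succ = β.1 j.succ := fun j => DFunLike.congr_fun h j
    have hα := α.2
    have hβ := β.2
    rw [Fin.sum_univ_succ] at hα hβ
    simp only [h'] at hα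
    refine Subtype.ext (funext fun k => Fin.cases ?_ h' k)
    omega
  let q : MvPolynomial (Fin n) ℝ := ∑ α, MvPolynomial.monomial (τ α) (u α)
  have hq : q = 0 := by
    refine MvPolynomial.funext fun z => ?_
    rw [map_zero, ← hu z]
    simp only [q, map_sum, MvPolynomial.eval_monomial, dotProduct]
    refine Finset.sum_congr rfl fun α _ => ?_
    rw [Finsupp.prod_fintype _ _ (fun i => pow_zero _)]
    simp [momentVec, veroneseVec, Fin.prod_univ_succ, τ]
  funext α
  have := congrArg (MvPolynomial.coeff (τ α)) hq
  simpa [q, MvPolynomial.coeff_sum, MvPolynomial.coeff_monomial, hτ.eq_iff] using this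

theorem exists_momentVec_dotProduct_mulVec_ne_zero {n d : ℕ}
    {S : Matrix (MultiIndex (n + 1) d) (MultiIndex (n + 1) d) ℝ} (hS : S ≠ 0) :
    ∃ z z' : Fin n → ℝ, momentVec d z ⬝ᵥ S *ᵥ momentVec d z' ≠ 0 := by
  by_contra! h
  refine hS (Matrix.ext fun α β => ?_)
  have h1 : ∀ z' : Fin n → ℝ, S *ᵥ momentVec d z' = 0 := fun z' =>
    eq_zero_of_dotProduct_momentVec _ fun z => by rw [dotProduct_comm, h]
  have h2 : S α = 0 := eq_zero_of_dotProduct_momentVec _ fun z => congrFun (h1 z) α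
  exact congrFun h2 β

/-- A symmetric matrix `S` orthogonal to all moment matrices which annihilates the moment vectors
of all the points except `z a` and `z b`, and pairs these two nontrivially. -/
structure SeparatesPair {n s : ℕ} (d : ℕ) (z : Fin s → Fin n → ℝ) (a b : Fin s)
    (S : Matrix (MultiIndex (n + 1) d) (MultiIndex (n + 1) d) ℝ) : Prop where
  symm : S.IsSymm
  orthogonal : ∀ l : Form (n + 1) (2 * d) →ₗ[ℝ] ℝ, ∑ α, ∑ β, S α β * l (monomialForm α β) = 0
  mulVec_eq_zero : ∀ i, i ≠ a → i ≠ b → S *ᵥ momentVec d (z i) = 0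
  pairing_ne_zero : momentVec d (z a) ⬝ᵥ S *ᵥ momentVec d (z b) ≠ 0

/-- The moment vector of the `i`-th point, with polynomial entries in the coordinates. -/
noncomputable def polyMomentVec {n s : ℕ} (d : ℕ) (i : Fin s) (α : MultiIndex (n + 1) d) :
    MvPolynomial (Fin s × Option (Fin n)) ℝ :=
  ∏ k, (Fin.cons 1 (fun j => MvPolynomial.X (i, some j)) :
    Fin (n + 1) → MvPolynomial (Fin s × Option (Fin n)) ℝ) k ^ α.1 k

theorem eval_polyMomentVec {n s d : ℕ} (i : Fin s) (α : MultiIndex (n + 1) d)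
    (c : Fin s × Option (Fin n) → ℝ) :
    MvPolynomial.eval c (polyMomentVec d i α) = momentVec d (fun j => c (i, some j)) α := by
  simp [polyMomentVec, momentVec, veroneseVec, Fin.prod_univ_succ]

/-- The linear system whose solutions are the symmetric matrices that are orthogonal to all moment
matrices and annihilate the moment vectors of the points of index in `A`. -/
noncomputable def annihilatorSystem {n s : ℕ} (d : ℕ) (A : Fin s → Prop) :
    (Sym2 (MultiIndex (n + 1) d) → MvPolynomial (Fin s × Option (Fin n)) ℝ) →ₗ[
      MvPolynomial (Fin s × Option (Fin n)) ℝ]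
    (MultiIndex (n + 1) (2 * d) ⊕ ({i // A i} × MultiIndex (n + 1) d) →
      MvPolynomial (Fin s × Option (Fin n)) ℝ) where
  toFun x := Sum.elim
    (fun γ => ∑ q : MultiIndex (n + 1) d × MultiIndex (n + 1) d with addIndex q.1 q.2 = γ,
      x s(q.1, q.2))
    (fun r => ∑ β, x s(r.2, β) * polyMomentVec d r.1.1 β)
  map_add' x y := by
    funext r
    rcases r with γ | r <;> simp [Finset.sum_add_distrib, add_mul]
  map_smul' x y := by
    funext r
    rcases r with γ | r <;> simp [Finset.mul_sum, mul_assoc]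

theorem exists_annihilatorSystem_eq_zero {n s d : ℕ} (a b : Fin s)
    (hbound : 2 * (s * (n + d).choose d + (n + 2 * d).choose (2 * d)) ≤
      (n + d).choose d * ((n + d).choose d + 1)) :
    ∃ x, x ≠ 0 ∧ annihilatorSystem (n := n) d (fun i : Fin s => i ≠ a ∧ i ≠ b) x = 0 := by
  classical
  -- Over a nontrivial commutative ring an injective linear map between free modules cannot lower
  -- the rank, so the count works directly with polynomial coefficients.
  by_contra! h
  have hinj : Function.Injective
      (annihilatorSystem (n := n) d (fun i : Fin s => i ≠ a ∧ i ≠ b)) :=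
    (injective_iff_map_eq_zero _).2 fun x hx => by
      by_contra hne
      exact h x hne hx
  have hcard := card_le_of_injective _ _ hinj
  rw [Sym2.card, Fintype.card_sum, Fintype.card_prod, card_multiIndex, card_multiIndex] at hcard
  -- Leaving out `a` and `b` makes the number of constrained points strictly less than `s`; this
  -- strictness is what lets the non-strict bound suffice.
  have hlt : Fintype.card {i : Fin s // i ≠ a ∧ i ≠ b} < s := by
    simpa using Fintype.card_subtype_lt (p := fun i : Fin s => i ≠ a ∧ i ≠ b) (x := a) (by simp)
  have hN : 0 < (n + d).choose d := Nat.choose_pos (by omega)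
  set N := (n + d).choose d
  have h2 : 2 * (N + 1).choose 2 = N * (N + 1) := by
    rw [Nat.choose_two_right, Nat.add_sub_cancel, Nat.mul_div_cancel', mul_comm]
    rw [mul_comm]
    exact (Nat.even_mul_succ_self N).two_dvd
  have h3 := Nat.mul_lt_mul_of_pos_right hlt hN
  omega

theorem exists_polynomial_separatesPair {n s d : ℕ} {a b : Fin s} (hab : a ≠ b)
    (hbound : 2 * (s * (n + d).choose d + (n + 2 * d).choose (2 * d)) ≤
      (n + d).choose d * ((n + d).choose d + 1)) :
    ∃ f : MvPolynomial (Fin s × Option (Fin n)) ℝ, f ≠ 0 ∧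
      ∀ p : Fin s → ℝ × (Fin n → ℝ), MvPolynomial.eval (paramCoords p) f ≠ 0 →
        ∃ S, SeparatesPair d (fun i => (p i).2) a b S := by
  classical
  obtain ⟨x, hx0, hx⟩ := exists_annihilatorSystem_eq_zero (n := n) a b hbound
  obtain ⟨e, he⟩ := Function.ne_iff.1 hx0
  obtain ⟨c₀, hc₀⟩ : ∃ c₀, MvPolynomial.eval c₀ (x e) ≠ 0 := by
    by_contra! h
    exact he (MvPolynomial.funext fun c => by simpa using h c)
  let S : (Fin s × Option (Fin n) → ℝ) → Matrix (MultiIndex (n + 1) d) (MultiIndex (n + 1) d) ℝ :=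
    fun c => Matrix.of fun α β => MvPolynomial.eval c (x s(α, β))
  have hS₀ : S c₀ ≠ 0 := by
    intro h
    induction e with
    | _ α β => exact hc₀ (congrFun (congrFun h α) β)
  obtain ⟨z, z', hz⟩ := exists_momentVec_dotProduct_mulVec_ne_zero hS₀
  -- Freeze the coordinates of the points `a` and `b` at those of `c₀`. No equation of the system
  -- involves them, so the frozen solution still solves it, and it no longer varies with these two
  -- points.
  let r : (Fin s × Option (Fin n) → ℝ) → Fin s × Option (Fin n) → ℝ := fun c q =>
    if q.1 = a ∨ q.1 = b then c₀ q else c q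
  let θ : MvPolynomial (Fin s × Option (Fin n)) ℝ →ₐ[ℝ] MvPolynomial (Fin s × Option (Fin n)) ℝ :=
    MvPolynomial.aeval fun q =>
      if q.1 = a ∨ q.1 = b then MvPolynomial.C (c₀ q) else MvPolynomial.X q
  have hθ : ∀ c g, MvPolynomial.eval c (θ g) = MvPolynomial.eval (r c) g := by
    intro c g
    induction g using MvPolynomial.induction_on with
    | C t => simp [θ]
    | add g h hg hh => simp [hg, hh]
    | mul_X g q hg =>
      rw [map_mul, map_mul, hg, map_mul]
      congr 1
      simp only [θ, r, MvPolynomial.aeval_X, MvPolynomial.eval_X]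
      split_ifs <;> simp
  let f : MvPolynomial (Fin s × Option (Fin n)) ℝ :=
    ∑ α, ∑ β, polyMomentVec d a α * (θ (x s(α, β)) * polyMomentVec d b β)
  have hf : ∀ c, MvPolynomial.eval c f = momentVec d (fun j => c (a, some j)) ⬝ᵥ
      S (r c) *ᵥ momentVec d (fun j => c (b, some j)) := by
    intro c
    simp only [f, map_sum, map_mul, hθ, eval_polyMomentVec, dotProduct, Matrix.mulVec, S,
      Matrix.of_apply, Finset.mul_sum]
  refine ⟨f, fun h0 => ?_, fun p hp => ⟨S (r (paramCoords p)), ?_, ?_, ?_, ?_⟩⟩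
  -- Moving only the points `a` and `b` to `z` and `z'` leaves the frozen matrix equal to `S c₀`, so
  -- `f` takes at `c` the nonzero value found above.
  · let c : Fin s × Option (Fin n) → ℝ := fun q =>
      if q.1 = a then q.2.elim 0 z else if q.1 = b then q.2.elim 0 z' else c₀ q
    have hrc : r c = c₀ := by
      funext q
      simp only [r, c]
      split_ifs <;> simp_all
    have h1 := hf c
    rw [h0, map_zero, hrc] at h1
    refine hz ?_
    simpa [c, hab.symm] using h1.symm
  · exact Matrix.IsSymm.ext fun α β => by simp [S, Sym2.eq_swap]
  · refine sum_mul_apply_monomialForm_eq_zero _ fun γ => ?_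
    have h1 := congrArg (MvPolynomial.eval (r (paramCoords p))) (congrFun hx (Sum.inl γ))
    simpa [annihilatorSystem, S] using h1
  · intro i hia hib
    funext α
    have h1 := congrArg (MvPolynomial.eval (r (paramCoords p)))
      (congrFun hx (Sum.inr (⟨i, hia, hib⟩, α)))
    simpa [annihilatorSystem, S, Matrix.mulVec, dotProduct, eval_polyMomentVec, r, hia, hib,
      paramCoords] using h1
  · rw [hf] at hp
    simpa [paramCoords] using hp

/-! ### Moment matrices -/

section Cone

variable {m d : ℕ}

theorem functionalMatrix_isSymm (l : Form m (2 * d) →ₗ[ℝ] ℝ) : (functionalMatrix l).IsSymm :=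
  Matrix.IsSymm.ext fun α β => by
    have h : addIndex β α = addIndex α β := Subtype.ext (add_comm _ _)
    simp [functionalMatrix, monomialForm_eq, h]

theorem dotProduct_functionalMatrix_mulVec (l : Form m (2 * d) →ₗ[ℝ] ℝ)
    (u : MultiIndex m d → ℝ) :
    u ⬝ᵥ functionalMatrix l *ᵥ u = l (Form.square (∑ α, u α • indexForm α)) := by
  have h : Form.square (∑ α, u α • indexForm α) =
      ∑ α, ∑ β, (u α * u β) • monomialForm α β := by
    refine Subtype.ext ?_
    simp only [Form.square, AddSubmonoidClass.coe_finsetSum, Submodule.coe_smul, sq,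
      Finset.sum_mul_sum]
    refine Finset.sum_congr rfl fun α _ => Finset.sum_congr rfl fun β _ => ?_
    simp only [indexForm, monomialForm, MvPolynomial.smul_monomial, MvPolynomial.monomial_mul]
    have hadd : Finsupp.equivFunOnFinite.symm α.1 + Finsupp.equivFunOnFinite.symm β.1 =
        (Finsupp.equivFunOnFinite.symm (α.1 + β.1) : Fin m →₀ ℕ) := Finsupp.ext fun _ => rfl
    rw [hadd]
    simp
  rw [h]
  simp only [map_sum, map_smul, functionalMatrix, dotProduct, Matrix.mulVec, Matrix.of_apply,
    Finset.mul_sum, smul_eq_mul]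
  refine Finset.sum_congr rfl fun α _ => Finset.sum_congr rfl fun β _ => ?_
  ring

theorem posSemidef_of_mem_pseudoMomentCone {M : Matrix (MultiIndex m d) (MultiIndex m d) ℝ}
    (hM : M ∈ pseudoMomentCone m d) : M.PosSemidef := by
  obtain ⟨l, hl, rfl⟩ := hM
  refine Matrix.PosSemidef.of_dotProduct_mulVec_nonneg ?_ fun u => ?_
  · rw [Matrix.IsHermitian, Matrix.conjTranspose_eq_transpose_of_trivial]
    exact functionalMatrix_isSymm l
  · rw [star_trivial, dotProduct_functionalMatrix_mulVec]
    exact hl _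

/-- Evaluation of forms at the point `x`. -/
noncomputable def evalForm (d : ℕ) (x : Fin m → ℝ) : Form m d →ₗ[ℝ] ℝ :=
  (MvPolynomial.aeval x : MvPolynomial (Fin m) ℝ →ₐ[ℝ] ℝ).toLinearMap ∘ₗ Submodule.subtype _

theorem evalForm_mem_sosDual (x : Fin m → ℝ) : evalForm (2 * d) x ∈ sosDual m d := by
  intro q
  simpa [evalForm, Form.square] using sq_nonneg _

theorem functionalMatrix_evalForm (x : Fin m → ℝ) :
    functionalMatrix (evalForm (2 * d) x) =
      Matrix.vecMulVec (veroneseVec d x) (veroneseVec d x) := by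
  ext α β
  simp only [functionalMatrix, evalForm, monomialForm, Matrix.of_apply, LinearMap.comp_apply,
    Submodule.subtype_apply, AlgHom.toLinearMap_apply, MvPolynomial.aeval_monomial,
    Matrix.vecMulVec_apply, veroneseVec, map_one, one_mul]
  rw [Finsupp.prod_fintype _ _ (fun i => pow_zero _), ← Finset.prod_mul_distrib]
  simp [pow_add]

theorem sum_smul_atomMatrix_mem {n s : ℕ} (z : Fin s → Fin n → ℝ) {c : Fin s → ℝ}
    {T : Finset (Fin s)} (hc : ∀ i ∈ T, 0 ≤ c i) :
    ∑ i ∈ T, c i • atomMatrix d (z i) ∈ pseudoMomentCone (n + 1) d := by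
  refine ⟨∑ i ∈ T, c i • evalForm (2 * d) (Fin.cons 1 (z i)), fun q => ?_, ?_⟩
  · rw [LinearMap.sum_apply]
    exact Finset.sum_nonneg fun i hi => mul_nonneg (hc i hi) (evalForm_mem_sosDual _ q)
  · simp only [atomMatrix, momentVec, ← functionalMatrix_evalForm]
    ext α β
    simp [functionalMatrix, Matrix.sum_apply]

end Cone

/-! ### The minimal face of a combination of atoms in general position -/

section Face

variable {n d s : ℕ}

theorem momentVec_constIndex (z : Fin n → ℝ) : momentVec d z (constIndex n d) = 1 := by
  simp [momentVec, veroneseVec, constIndex, Fin.prod_univ_succ]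

theorem momentVec_linIndex (hd : 0 < d) (z : Fin n → ℝ) (j : Fin n) :
    momentVec d z (linIndex hd j) = z j := by
  simp [momentVec, veroneseVec, linIndex, Fin.prod_univ_succ, Pi.single_apply]

theorem atomMatrix_mulVec (z : Fin n → ℝ) (v : MultiIndex (n + 1) d → ℝ) :
    atomMatrix d z *ᵥ v = (v ⬝ᵥ momentVec d z) • momentVec d z := by
  ext α
  simp [atomMatrix, Matrix.mulVec, dotProduct, Matrix.vecMulVec_apply, Finset.sum_mul]
  refine Finset.sum_congr rfl fun β _ => ?_
  ring

theorem sum_sum_mul_atomMatrix (S : Matrix (MultiIndex (n + 1) d) (MultiIndex (n + 1) d) ℝ)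
    (z : Fin n → ℝ) :
    ∑ α, ∑ β, S α β * atomMatrix d z α β = momentVec d z ⬝ᵥ S *ᵥ momentVec d z := by
  simp only [atomMatrix, Matrix.mulVec, dotProduct, Matrix.vecMulVec_apply, Finset.mul_sum]
  refine Finset.sum_congr rfl fun α _ => Finset.sum_congr rfl fun β _ => ?_
  ring

/-- Evaluation at the point is a linear functional with moment matrix m_d(x) m_d(x)ᵀ, to which S is
orthogonal. -/
theorem SeparatesPair.pairing_self {z : Fin s → Fin n → ℝ} {a b : Fin s}
    {S : Matrix (MultiIndex (n + 1) d) (MultiIndex (n + 1) d) ℝ} (hS : SeparatesPair d z a b S)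
    (x : Fin n → ℝ) : momentVec d x ⬝ᵥ S *ᵥ momentVec d x = 0 := by
  rw [← sum_sum_mul_atomMatrix, ← hS.orthogonal (evalForm (2 * d) (Fin.cons 1 x))]
  refine Finset.sum_congr rfl fun α _ => Finset.sum_congr rfl fun β _ => ?_
  rw [atomMatrix, momentVec, ← functionalMatrix_evalForm]
  rfl

theorem SeparatesPair.pairing_comm {z : Fin s → Fin n → ℝ} {a b : Fin s}
    {S : Matrix (MultiIndex (n + 1) d) (MultiIndex (n + 1) d) ℝ} (hS : SeparatesPair d z a b S)
    (v w : MultiIndex (n + 1) d → ℝ) : v ⬝ᵥ S *ᵥ w = w ⬝ᵥ S *ᵥ v := by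
  conv_lhs => rw [← hS.symm.eq]
  rw [Matrix.mulVec_transpose, dotProduct_comm, Matrix.dotProduct_mulVec]

/-- The vector S v_b, for S separating i from b, kills every v_j with j ≠ i: for j = b by
`pairing_self`, otherwise by annihilation. Rescaling makes it dual to v_i. With a single point there
is no b, and the coordinate of the monomial 1 serves. -/
theorem exists_dual_momentVec {z : Fin s → Fin n → ℝ}
    (hz : ∀ a b, a ≠ b → ∃ S, SeparatesPair d z a b S) :
    ∃ u : Fin s → MultiIndex (n + 1) d → ℝ,
      ∀ i j, u i ⬝ᵥ momentVec d (z j) = if i = j then 1 else 0 := by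
  suffices h : ∀ i, ∃ u : MultiIndex (n + 1) d → ℝ,
      ∀ j, u ⬝ᵥ momentVec d (z j) = if i = j then 1 else 0 from
    ⟨fun i => (h i).choose, fun i => (h i).choose_spec⟩
  intro i
  by_cases hi : ∃ b, i ≠ b
  · obtain ⟨b, hib⟩ := hi
    obtain ⟨S, hS⟩ := hz i b hib
    refine ⟨(momentVec d (z i) ⬝ᵥ S *ᵥ momentVec d (z b))⁻¹ • S *ᵥ momentVec d (z b),
      fun j => ?_⟩
    rw [smul_dotProduct, dotProduct_comm _ (momentVec d (z j)), smul_eq_mul]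
    by_cases hij : i = j
    · subst hij
      simpa using inv_mul_cancel₀ hS.pairing_ne_zero
    · rw [if_neg hij]
      by_cases hjb : j = b
      · rw [hjb, hS.pairing_self, mul_zero]
      · rw [hS.pairing_comm (momentVec d (z j)), hS.mulVec_eq_zero j (Ne.symm hij) hjb, dotProduct_zero, mul_zero]
  · push Not at hi
    refine ⟨Pi.single (constIndex n d) 1, fun j => ?_⟩
    rw [if_pos (hi j), single_dotProduct, momentVec_constIndex, one_mul]

theorem sum_atomMatrix_mulVec (z : Fin s → Fin n → ℝ) (T : Finset (Fin s)) (c : Fin s → ℝ)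
    (v : MultiIndex (n + 1) d → ℝ) :
    (∑ i ∈ T, c i • atomMatrix d (z i)) *ᵥ v =
      ∑ i ∈ T, (c i * (v ⬝ᵥ momentVec d (z i))) • momentVec d (z i) := by
  simp only [Matrix.sum_mulVec, Matrix.smul_mulVec, atomMatrix_mulVec, smul_smul]

theorem dotProduct_sum_atomMatrix_mulVec (z : Fin s → Fin n → ℝ) (T : Finset (Fin s))
    (c : Fin s → ℝ) (v : MultiIndex (n + 1) d → ℝ) :
    v ⬝ᵥ (∑ i ∈ T, c i • atomMatrix d (z i)) *ᵥ v =
      ∑ i ∈ T, c i * (v ⬝ᵥ momentVec d (z i)) ^ 2 := by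
  rw [sum_atomMatrix_mulVec, dotProduct_sum]
  refine Finset.sum_congr rfl fun i _ => ?_
  rw [dotProduct_smul, smul_eq_mul]
  ring

theorem linearIndependent_atomMatrix {z : Fin s → Fin n → ℝ}
    (hz : ∀ a b, a ≠ b → ∃ S, SeparatesPair d z a b S) :
    LinearIndependent ℝ fun i => atomMatrix d (z i) := by
  obtain ⟨u, hu⟩ := exists_dual_momentVec hz
  refine Fintype.linearIndependent_iff.2 fun c hc i => ?_
  have h := dotProduct_sum_atomMatrix_mulVec z Finset.univ c (u i)
  rw [hc] at h
  simpa [hu] using h.symm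

/-- The cone spanned by the `A i` with `i ∈ T`. -/
def atomCone {E ι : Type*} [AddCommGroup E] [Module ℝ E] (A : ι → E) (T : Finset ι) : Set E :=
  {Y | ∃ c : ι → ℝ, (∀ i, 0 ≤ c i) ∧ Y = ∑ i ∈ T, c i • A i}

theorem mem_atomCone_of_mem_pseudoMomentCone {z : Fin s → Fin n → ℝ}
    (hz : ∀ a b, a ≠ b → ∃ S, SeparatesPair d z a b S) (T : Finset (Fin s))
    {M : Matrix (MultiIndex (n + 1) d) (MultiIndex (n + 1) d) ℝ}
    (hM : M ∈ pseudoMomentCone (n + 1) d)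
    (hker : ∀ v, (∀ i ∈ T, v ⬝ᵥ momentVec d (z i) = 0) → v ⬝ᵥ M *ᵥ v = 0) :
    M ∈ atomCone (fun i => atomMatrix d (z i)) T := by
  classical
  obtain ⟨u, hu⟩ := exists_dual_momentVec hz
  have hpsd := posSemidef_of_mem_pseudoMomentCone hM
  have hsymm : ∀ v w, v ⬝ᵥ M *ᵥ w = w ⬝ᵥ M *ᵥ v := by
    intro v w
    have h : Mᵀ = M := by
      simpa [Matrix.IsHermitian, Matrix.conjTranspose_eq_transpose_of_trivial] using
        hpsd.isHermitian
    conv_lhs => rw [← h]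
    rw [Matrix.mulVec_transpose, dotProduct_comm, Matrix.dotProduct_mulVec]
  have hM1 : ∀ v, M *ᵥ v = ∑ i ∈ T, (v ⬝ᵥ momentVec d (z i)) • M *ᵥ u i := by
    intro v
    -- The difference is orthogonal to every v_i with i ∈ T, hence isotropic for M; for a positive
    -- semidefinite matrix isotropic vectors lie in the kernel.
    have h0 : M *ᵥ (v - ∑ i ∈ T, (v ⬝ᵥ momentVec d (z i)) • u i) = 0 := by
      refine (hpsd.dotProduct_mulVec_zero_iff _).1 ?_
      rw [star_trivial]
      refine hker _ fun j hj => ?_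
      simp [sub_dotProduct, sum_dotProduct, hu, hj]
    rw [Matrix.mulVec_sub, sub_eq_zero] at h0
    rw [h0, Matrix.mulVec_sum]
    simp only [Matrix.mulVec_smul]
  have hM2 : ∀ v w, v ⬝ᵥ M *ᵥ w = ∑ i ∈ T, ∑ j ∈ T,
      (v ⬝ᵥ momentVec d (z j)) * (w ⬝ᵥ momentVec d (z i)) * (u i ⬝ᵥ M *ᵥ u j) := by
    intro v w
    rw [hM1 w, dotProduct_sum]
    refine Finset.sum_congr rfl fun i _ => ?_
    rw [dotProduct_smul, hsymm, hM1 v, dotProduct_sum, smul_eq_mul, Finset.mul_sum]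
    refine Finset.sum_congr rfl fun j _ => ?_
    rw [dotProduct_smul, smul_eq_mul]
    ring
  have hM3 : M = ∑ i ∈ T, ∑ j ∈ T, (u i ⬝ᵥ M *ᵥ u j) •
      Matrix.vecMulVec (momentVec d (z j)) (momentVec d (z i)) := by
    ext α β
    have h := hM2 (Pi.single α 1) (Pi.single β 1)
    simp only [Matrix.mulVec_single_one, single_one_dotProduct, Matrix.col_apply] at h
    rw [h]
    simp only [Matrix.sum_apply, Matrix.smul_apply, Matrix.vecMulVec_apply, smul_eq_mul]
    refine Finset.sum_congr rfl fun i _ => Finset.sum_congr rfl fun j _ => mul_comm _ _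
  have hoff : ∀ a ∈ T, ∀ b ∈ T, a ≠ b → u a ⬝ᵥ M *ᵥ u b = 0 := by
    intro a ha b hb hab
    obtain ⟨S, hS⟩ := hz a b hab
    set p := momentVec d (z a) ⬝ᵥ S *ᵥ momentVec d (z b) with hp
    have h0 : (S * M).trace = 0 := by
      obtain ⟨l, -, rfl⟩ := hM
      rw [← hS.orthogonal l, Matrix.trace]
      refine Finset.sum_congr rfl fun α _ => ?_
      rw [Matrix.diag_apply, Matrix.mul_apply]
      refine Finset.sum_congr rfl fun β _ => ?_
      rw [← (functionalMatrix_isSymm l).apply]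
      rfl
    have h1 : (S * M).trace = ∑ i ∈ T, ∑ j ∈ T,
        (u i ⬝ᵥ M *ᵥ u j) * (momentVec d (z i) ⬝ᵥ S *ᵥ momentVec d (z j)) := by
      conv_lhs => rw [hM3]
      simp only [Finset.mul_sum, Matrix.trace_sum, Matrix.mul_smul, Matrix.trace_smul,
        Matrix.mul_vecMulVec, Matrix.trace_vecMulVec, smul_eq_mul]
      simp only [dotProduct_comm]
    -- Diagonal terms vanish by `pairing_self` and terms with an index outside {a, b} by
    -- annihilation, so only (a, b) and (b, a) contribute, equally.
    have h2 : ∀ i j, (u i ⬝ᵥ M *ᵥ u j) * (momentVec d (z i) ⬝ᵥ S *ᵥ momentVec d (z j)) =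
        (if i = a then if j = b then (u a ⬝ᵥ M *ᵥ u b) * p else 0 else 0) +
          (if i = b then if j = a then (u a ⬝ᵥ M *ᵥ u b) * p else 0 else 0) := by
      intro i j
      by_cases hij : i = j
      · subst hij
        rw [hS.pairing_self]
        by_cases hia : i = a
        · simp [hia, hab]
        · simp [hia]
      by_cases hi : i ≠ a ∧ i ≠ b
      · rw [hS.pairing_comm, hS.mulVec_eq_zero i hi.1 hi.2]
        simp [hi]
      by_cases hj : j ≠ a ∧ j ≠ b
      · rw [hS.mulVec_eq_zero j hj.1 hj.2]
        simp [hj]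
      have hcases : (i = a ∧ j = b) ∨ (i = b ∧ j = a) := by
        have hi' : i = a ∨ i = b := by tauto
        have hj' : j = a ∨ j = b := by tauto
        rcases hi' with hi' | hi' <;> rcases hj' with hj' | hj'
        · exact absurd (hi'.trans hj'.symm) hij
        · exact Or.inl ⟨hi', hj'⟩
        · exact Or.inr ⟨hi', hj'⟩
        · exact absurd (hi'.trans hj'.symm) hij
      rcases hcases with ⟨rfl, rfl⟩ | ⟨rfl, rfl⟩
      · simp [hab, hp]
      · rw [hsymm, hS.pairing_comm]
        simp [hab.symm, hp]
    rw [h1] at h0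
    simp only [h2, Finset.sum_add_distrib, Finset.sum_ite_irrel, Finset.sum_ite_eq', ha, hb,
      Finset.sum_const_zero, if_true] at h0
    have h3 : (u a ⬝ᵥ M *ᵥ u b) * p = 0 := by linarith
    exact (mul_eq_zero.1 h3).resolve_right hS.pairing_ne_zero
  refine ⟨fun i => u i ⬝ᵥ M *ᵥ u i, fun i => ?_, ?_⟩
  · simpa using hpsd.dotProduct_mulVec_nonneg (u i)
  · conv_lhs => rw [hM3]
    refine Finset.sum_congr rfl fun i hi => ?_
    rw [Finset.sum_eq_single i (fun j hj hji => by rw [hoff i hi j hj hji.symm, zero_smul])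
      (fun h => absurd hi h)]
    rfl

/-- The cone is cut out by vanishing of the quadratic form on the complement of the v_i, i ∈ T. Two
nonnegative forms with a vanishing positive combination both vanish, so this condition passes to the
endpoints of a segment. -/
theorem isExtreme_atomCone {z : Fin s → Fin n → ℝ}
    (hz : ∀ a b, a ≠ b → ∃ S, SeparatesPair d z a b S) (T : Finset (Fin s)) :
    IsExtreme ℝ (pseudoMomentCone (n + 1) d) (atomCone (fun i => atomMatrix d (z i)) T) := by
  refine ⟨?_, ?_⟩
  · rintro _ ⟨c, hc, rfl⟩
    exact sum_smul_atomMatrix_mem z fun i _ => hc i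
  · rintro x hx y hy _ ⟨c, hc, rfl⟩ ⟨a, b, ha, hb, -, hab⟩
    refine mem_atomCone_of_mem_pseudoMomentCone hz T hx fun v hv => ?_
    have h1 := dotProduct_sum_atomMatrix_mulVec z T c v
    rw [Finset.sum_eq_zero (f := fun i => c i * (v ⬝ᵥ momentVec d (z i)) ^ 2)
      (fun i hi => by rw [hv i hi]; simp)] at h1
    change v ⬝ᵥ (∑ i ∈ T, c i • (fun i => atomMatrix d (z i)) i) *ᵥ v = 0 at h1
    rw [← hab, Matrix.add_mulVec,
      dotProduct_add, Matrix.smul_mulVec, Matrix.smul_mulVec, dotProduct_smul, dotProduct_smul,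
      smul_eq_mul, smul_eq_mul] at h1
    have hx0 := (posSemidef_of_mem_pseudoMomentCone hx).dotProduct_mulVec_nonneg v
    have hy0 := (posSemidef_of_mem_pseudoMomentCone hy).dotProduct_mulVec_nonneg v
    rw [star_trivial] at hx0 hy0
    have h2 := mul_nonneg hb.le hy0
    have h3 : a * (v ⬝ᵥ x *ᵥ v) ≤ 0 := by linarith
    exact le_antisymm (nonpos_of_mul_nonpos_right h3 ha) hx0

theorem convex_atomCone {E ι : Type*} [AddCommGroup E] [Module ℝ E] (A : ι → E) (T : Finset ι) :
    Convex ℝ (atomCone A T) := by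
  rintro _ ⟨c, hc, rfl⟩ _ ⟨e, he, rfl⟩ a b ha hb -
  refine ⟨fun i => a * c i + b * e i,
    fun i => add_nonneg (mul_nonneg ha (hc i)) (mul_nonneg hb (he i)), ?_⟩
  simp only [Finset.smul_sum, smul_smul, add_smul, Finset.sum_add_distrib]

theorem minface_sum_atomMatrix {z : Fin s → Fin n → ℝ}
    (hz : ∀ a b, a ≠ b → ∃ S, SeparatesPair d z a b S) (T : Finset (Fin s)) {x : Fin s → ℝ}
    (hx : ∀ i, 0 < x i) :
    minface (∑ i ∈ T, x i • atomMatrix d (z i)) (pseudoMomentCone (n + 1) d) =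
      atomCone (fun i => atomMatrix d (z i)) T := by
  refine Set.Subset.antisymm ?_ ?_
  · exact Set.sInter_subset_of_mem
      ⟨isExtreme_atomCone hz T, convex_atomCone _ _, x, fun i => (hx i).le, rfl⟩
  · rintro _ ⟨c, hc, rfl⟩ F ⟨hF, -, hxF⟩
    -- All x_i are positive, so the segment from Σ c_i A_i to Σ x_i A_i can be prolonged inside the
    -- cone. The far endpoint (x - εc)/(1 - ε) needs εc ≤ x.
    obtain ⟨ε, hε0, hε1, hε⟩ : ∃ ε : ℝ, 0 < ε ∧ ε < 1 ∧ ∀ i, ε * c i ≤ x i := by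
      have h : ∀ᶠ ε : ℝ in nhdsWithin 0 (Set.Ioi 0), ∀ i, ε * c i < x i := by
        refine Filter.eventually_all.2 fun i => ?_
        have ht : Filter.Tendsto (fun ε : ℝ => ε * c i) (nhdsWithin 0 (Set.Ioi 0)) (nhds 0) := by
          refine Filter.Tendsto.mono_left ?_ nhdsWithin_le_nhds
          simpa using (continuous_mul_const (c i)).tendsto (0 : ℝ)
        exact ht.eventually_lt_const (hx i)
      have h1 : ∀ᶠ ε : ℝ in nhdsWithin 0 (Set.Ioi 0), ε < 1 :=
        nhdsWithin_le_nhds (eventually_lt_nhds zero_lt_one)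
      obtain ⟨ε, h2, h3, h4⟩ := (h.and (h1.and self_mem_nhdsWithin)).exists
      exact ⟨ε, h4, h3, fun i => (h2 i).le⟩
    have h1ε : 0 < 1 - ε := sub_pos.2 hε1
    refine hF.left_mem_of_mem_openSegment (sum_smul_atomMatrix_mem z fun i _ => hc i)
      (y := ∑ i ∈ T, ((1 - ε)⁻¹ * (x i - ε * c i)) • atomMatrix d (z i))
      (sum_smul_atomMatrix_mem z fun i _ =>
        mul_nonneg (inv_nonneg.2 h1ε.le) (sub_nonneg.2 (hε i)))
      hxF ⟨ε, 1 - ε, hε0, h1ε, by ring, ?_⟩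
    simp only [Finset.smul_sum, smul_smul, ← Finset.sum_add_distrib, ← add_smul]
    refine Finset.sum_congr rfl fun i _ => ?_
    congr 1
    rw [mul_inv_cancel_left₀ h1ε.ne']
    ring

end Face

/-! ### The algorithm on a cone with simplicial minimal faces -/

section Run

theorem eq_of_sum_smul_eq {E ι : Type*} [AddCommGroup E] [Module ℝ E] {A : ι → E}
    (hA : LinearIndependent ℝ A) {T : Finset ι} {c e : ι → ℝ}
    (h : ∑ i ∈ T, c i • A i = ∑ i ∈ T, e i • A i) : ∀ i ∈ T, c i = e i := by
  intro i hi
  have h1 : ∑ i ∈ T, (c i - e i) • A i = 0 := by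
    simp only [sub_smul, Finset.sum_sub_distrib, h, sub_self]
  exact sub_eq_zero.1 (linearIndependent_iff'.1 hA T _ h1 i hi)

variable {ι : Type*} [Fintype ι] {s : ℕ} {A : Fin s → Matrix ι ι ℝ} {C : Set (Matrix ι ι ℝ)}
  {x : Fin s → ℝ}

/-- The value of the objective `tr (B Y)` at the normalized atom `Y = A / tr A`. -/
noncomputable def atomObjective (A : Fin s → Matrix ι ι ℝ) (B : Matrix ι ι ℝ) (i : Fin s) : ℝ :=
  (B * A i).trace / (A i).trace

theorem trace_sum_smul (T : Finset (Fin s)) (c : Fin s → ℝ) :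
    (∑ i ∈ T, c i • A i).trace = ∑ i ∈ T, c i * (A i).trace := by
  simp [Matrix.trace_sum, Matrix.trace_smul]

theorem trace_mul_sum_smul (htr : ∀ i, 0 < (A i).trace) (B : Matrix ι ι ℝ) (T : Finset (Fin s))
    (c : Fin s → ℝ) :
    (B * ∑ i ∈ T, c i • A i).trace = ∑ i ∈ T, c i * (A i).trace * atomObjective A B i := by
  simp only [Finset.mul_sum, Matrix.trace_sum, Matrix.mul_smul, Matrix.trace_smul, smul_eq_mul]
  refine Finset.sum_congr rfl fun i _ => ?_
  rw [atomObjective, mul_assoc, mul_div_cancel₀ _ (htr i).ne']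

theorem inv_trace_smul_mem_atomCone (htr : ∀ i, 0 < (A i).trace) {T : Finset (Fin s)} {i : Fin s}
    (hi : i ∈ T) : (A i).trace⁻¹ • A i ∈ atomCone A T := by
  classical
  refine ⟨Pi.single i (A i).trace⁻¹, fun j => ?_, ?_⟩
  · by_cases h : j = i
    · subst h
      simpa using (htr j).le
    · simp [h]
  · rw [Finset.sum_eq_single i (fun j _ hji => by simp [hji]) (fun h => absurd hi h)]
    simp

/-- Coefficients are unique by independence, and subtracting a multiple of A_i changes only the i-th
one, so its nonnegativity is the sole constraint. -/
theorem stepLengths_eq_Icc (hA : LinearIndependent ℝ A) (htr : ∀ i, 0 < (A i).trace)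
    (hx : ∀ i, 0 < x i) {T : Finset (Fin s)} {i : Fin s} (hi : i ∈ T) :
    {τ : ℝ | 0 ≤ τ ∧ ∑ j ∈ T, x j • A j - τ • ((A i).trace⁻¹ • A i) ∈ atomCone A T} =
      Set.Icc 0 (x i * (A i).trace) := by
  classical
  have hsum : ∀ τ : ℝ, ∑ j ∈ T, x j • A j - τ • ((A i).trace⁻¹ • A i) =
      ∑ j ∈ T, (x j - if j = i then τ * (A i).trace⁻¹ else 0) • A j := by
    intro τ
    simp only [sub_smul, Finset.sum_sub_distrib, ite_smul, zero_smul]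
    rw [Finset.sum_ite_eq' T i, if_pos hi, smul_smul]
  ext τ
  simp only [Set.mem_ofPred_eq, Set.mem_Icc, hsum]
  refine and_congr_right fun hτ => ⟨?_, fun h => ⟨_, fun j => ?_, rfl⟩⟩
  · rintro ⟨c, hc, h⟩
    have h1 := eq_of_sum_smul_eq hA h i hi
    have h2 := hc i
    rw [← h1, if_pos rfl, sub_nonneg, ← div_eq_mul_inv, div_le_iff₀ (htr i)] at h2
    exact h2
  · split_ifs with hji
    · subst hji
      rwa [sub_nonneg, ← div_eq_mul_inv, div_le_iff₀ (htr j)]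
    · simpa using (hx j).le

theorem sub_smul_eq_sum_erase (htr : ∀ i, 0 < (A i).trace) {T : Finset (Fin s)} {i : Fin s}
    (hi : i ∈ T) :
    ∑ j ∈ T, x j • A j - (x i * (A i).trace) • ((A i).trace⁻¹ • A i) =
      ∑ j ∈ T.erase i, x j • A j := by
  rw [smul_smul, mul_inv_cancel_right₀ (htr i).ne', ← Finset.add_sum_erase T _ hi,
    add_sub_cancel_left]

theorem RayStep.eq_atom (hA : LinearIndependent ℝ A) (htr : ∀ i, 0 < (A i).trace)
    (hx : ∀ i, 0 < x i)
    (hface : ∀ T : Finset (Fin s), minface (∑ i ∈ T, x i • A i) C = atomCone A T)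
    {B : Matrix ι ι ℝ} (hB : Function.Injective (atomObjective A B)) {T : Finset (Fin s)}
    {M X' : Matrix ι ι ℝ} {t : ℝ} (h : RayStep C B (∑ i ∈ T, x i • A i) M t X') :
    ∃ i ∈ T, t = x i * (A i).trace ∧ M = (A i).trace⁻¹ • A i ∧
      X' = ∑ j ∈ T.erase i, x j • A j := by
  classical
  have hT : T.Nonempty := by
    rw [Finset.nonempty_iff_ne_empty]
    rintro rfl
    exact h.ne_zero (by simp)
  obtain ⟨i, hi, hmin⟩ := T.exists_min_image (atomObjective A B) hT
  have hM := h.mem_face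
  rw [hface] at hM
  obtain ⟨c, hc, hMc⟩ := hM
  have htrM := h.trace_eq_one
  rw [hMc, trace_sum_smul] at htrM
  have hle := h.minimal ((A i).trace⁻¹ • A i)
    (by rw [hface]; exact inv_trace_smul_mem_atomCone htr hi)
    (by rw [Matrix.trace_smul, smul_eq_mul, inv_mul_cancel₀ (htr i).ne'])
  have hobj : (B * (A i).trace⁻¹ • A i).trace = atomObjective A B i := by
    rw [Matrix.mul_smul, Matrix.trace_smul, smul_eq_mul, atomObjective, div_eq_inv_mul]
  rw [hobj, hMc, trace_mul_sum_smul htr] at hle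
  have hterm : ∀ j ∈ T,
      0 ≤ c j * (A j).trace * (atomObjective A B j - atomObjective A B i) := fun j hj =>
    mul_nonneg (mul_nonneg (hc j) (htr j).le) (sub_nonneg.2 (hmin j hj))
  -- The numbers c_j tr A_j are convex weights and the objective at M is the corresponding average
  -- of atom values. An average not exceeding the minimum puts no weight on atoms with larger
  -- values.
  have hsum : ∑ j ∈ T, c j * (A j).trace * (atomObjective A B j - atomObjective A B i) = 0 := by
    refine le_antisymm ?_ (Finset.sum_nonneg hterm)
    simp only [mul_sub, Finset.sum_sub_distrib, ← Finset.sum_mul, htrM, one_mul]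
    exact sub_nonpos.2 hle
  have hc0 : ∀ j ∈ T, j ≠ i → c j = 0 := by
    intro j hj hji
    have h1 := (Finset.sum_eq_zero_iff_of_nonneg hterm).1 hsum j hj
    have h2 : atomObjective A B j - atomObjective A B i ≠ 0 := fun h0 =>
      hji (hB (sub_eq_zero.1 h0))
    exact (mul_eq_zero.1 ((mul_eq_zero.1 h1).resolve_right h2)).resolve_right (htr j).ne'
  have hci : c i = (A i).trace⁻¹ := by
    rw [Finset.sum_eq_single i (fun j hj hji => by rw [hc0 j hj hji, zero_mul])
      (fun h0 => absurd hi h0)] at htrM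
    exact eq_inv_of_mul_eq_one_left htrM
  have hMi : M = (A i).trace⁻¹ • A i := by
    rw [hMc, Finset.sum_eq_single i (fun j hj hji => by rw [hc0 j hj hji, zero_smul])
      (fun h0 => absurd hi h0), hci]
  have ht : t = x i * (A i).trace := by
    have h1 := h.step_length
    rw [hface, hMi, stepLengths_eq_Icc hA htr hx hi] at h1
    exact h1.unique (isLUB_Icc (mul_pos (hx i) (htr i)).le)
  exact ⟨i, hi, ht, hMi, by rw [h.next_eq, ht, hMi, sub_smul_eq_sum_erase htr hi]⟩

theorem exists_rayStep (hA : LinearIndependent ℝ A) (htr : ∀ i, 0 < (A i).trace)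
    (hx : ∀ i, 0 < x i)
    (hface : ∀ T : Finset (Fin s), minface (∑ i ∈ T, x i • A i) C = atomCone A T)
    (B : Matrix ι ι ℝ) {T : Finset (Fin s)} (hT : T.Nonempty) :
    ∃ M t X', RayStep C B (∑ i ∈ T, x i • A i) M t X' := by
  obtain ⟨i, hi, hmin⟩ := T.exists_min_image (atomObjective A B) hT
  refine ⟨(A i).trace⁻¹ • A i, x i * (A i).trace, _, ?_, ?_, ?_, ?_, ?_, rfl⟩
  · intro h0
    exact (hx i).ne' (linearIndependent_iff'.1 hA T x h0 i hi)
  · rw [hface]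
    exact inv_trace_smul_mem_atomCone htr hi
  · rw [Matrix.trace_smul, smul_eq_mul, inv_mul_cancel₀ (htr i).ne']
  · rw [hface]
    rintro _ ⟨c, hc, rfl⟩ htrY
    rw [trace_sum_smul] at htrY
    rw [trace_mul_sum_smul htr, Matrix.mul_smul, Matrix.trace_smul, smul_eq_mul, ← div_eq_inv_mul]
    calc atomObjective A B i = ∑ j ∈ T, c j * (A j).trace * atomObjective A B i := by
          rw [← Finset.sum_mul, htrY, one_mul]
      _ ≤ _ := Finset.sum_le_sum fun j hj =>
          mul_le_mul_of_nonneg_left (hmin j hj) (mul_nonneg (hc j) (htr j).le)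
  · rw [hface, stepLengths_eq_Icc hA htr hx hi]
    exact isLUB_Icc (mul_pos (hx i) (htr i)).le

theorem IsRun.init {B : ℕ → Matrix ι ι ℝ} {X₀ : Matrix ι ι ℝ} {r : ℕ}
    {X : Fin (r + 1 + 1) → Matrix ι ι ℝ} {t : Fin (r + 1) → ℝ} {M : Fin (r + 1) → Matrix ι ι ℝ}
    (h : IsRun C B X₀ (r + 1) X t M) :
    IsRun C B X₀ r (fun k => X k.castSucc) (fun k => t k.castSucc) (fun k => M k.castSucc) :=
  ⟨h.start, fun k => h.step k.castSucc⟩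

theorem IsRun.snoc {B : ℕ → Matrix ι ι ℝ} {X₀ : Matrix ι ι ℝ} {r : ℕ}
    {X : Fin (r + 1) → Matrix ι ι ℝ} {t : Fin r → ℝ} {M : Fin r → Matrix ι ι ℝ}
    (h : IsRun C B X₀ r X t M) {M' X' : Matrix ι ι ℝ} {t' : ℝ}
    (h' : RayStep C (B r) (X (Fin.last r)) M' t' X') :
    IsRun C B X₀ (r + 1) (Fin.snoc (α := fun _ => Matrix ι ι ℝ) X X')
      (Fin.snoc (α := fun _ => ℝ) t t') (Fin.snoc (α := fun _ => Matrix ι ι ℝ) M M') := by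
  refine ⟨?_, fun k => ?_⟩
  · rw [← Fin.castSucc_zero, Fin.snoc_castSucc]
    exact h.start
  · induction k using Fin.lastCases with
    | last => simpa [Fin.succ_last] using h'
    | cast k =>
      simp only [← Fin.castSucc_succ, Fin.snoc_castSucc, Fin.val_castSucc]
      exact h.step k

/-- Every run splits off distinct atoms, one in each iteration. -/
theorem IsRun.exists_injective (hA : LinearIndependent ℝ A) (htr : ∀ i, 0 < (A i).trace)
    (hx : ∀ i, 0 < x i)
    (hface : ∀ T : Finset (Fin s), minface (∑ i ∈ T, x i • A i) C = atomCone A T)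
    {B : ℕ → Matrix ι ι ℝ} (hB : ∀ k, Function.Injective (atomObjective A (B k))) {r : ℕ}
    {X : Fin (r + 1) → Matrix ι ι ℝ} {t : Fin r → ℝ} {M : Fin r → Matrix ι ι ℝ}
    (h : IsRun C B (∑ i, x i • A i) r X t M) :
    ∃ σ : Fin r → Fin s, Function.Injective σ ∧
      (∀ k, t k = x (σ k) * (A (σ k)).trace ∧ M k = (A (σ k)).trace⁻¹ • A (σ k)) ∧
      X (Fin.last r) = ∑ i with ∀ k, σ k ≠ i, x i • A i := by
  classical
  induction r with
  | zero =>
    refine ⟨Fin.elim0, fun k => k.elim0, fun k => k.elim0, ?_⟩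
    simpa using h.start
  | succ r ih =>
    obtain ⟨σ, hσ, htM, hX⟩ := ih h.init
    have hstep : RayStep C (B r) (X (Fin.last r).castSucc) _ _ _ := h.step (Fin.last r)
    rw [hX] at hstep
    obtain ⟨i, hi, ht, hM, hX'⟩ := hstep.eq_atom hA htr hx hface (hB r)
    simp only [Finset.mem_filter, Finset.mem_univ, true_and] at hi
    refine ⟨Fin.snoc (α := fun _ => Fin s) σ i, ?_, fun k => ?_, ?_⟩
    · intro k l hkl
      induction k using Fin.lastCases with
      | last =>
        induction l using Fin.lastCases with
        | last => rfl
        | cast l => exact absurd (by simpa using hkl.symm) (hi l)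
      | cast k =>
        induction l using Fin.lastCases with
        | last => exact absurd (by simpa using hkl) (hi k)
        | cast l => exact congrArg Fin.castSucc (hσ (by simpa using hkl))
    · induction k using Fin.lastCases with
      | last => simpa using ⟨ht, hM⟩
      | cast k => simpa using htM k
    · rw [← Fin.succ_last, hX']
      refine Finset.sum_congr ?_ fun _ _ => rfl
      ext j
      simp only [Finset.mem_erase, Finset.mem_filter, Finset.mem_univ, true_and,
        Fin.forall_fin_succ', Fin.snoc_castSucc, Fin.snoc_last]
      exact ⟨fun h => ⟨h.2, Ne.symm h.1⟩, fun h => ⟨Ne.symm h.2, h.1⟩⟩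

theorem exists_notMem_of_lt {r s : ℕ} (σ : Fin r → Fin s) (h : r < s) : ∃ i, ∀ k, σ k ≠ i := by
  by_contra! h'
  have := Fintype.card_le_of_surjective σ h'
  simp only [Fintype.card_fin] at this
  omega

theorem exists_isRun (hA : LinearIndependent ℝ A) (htr : ∀ i, 0 < (A i).trace)
    (hx : ∀ i, 0 < x i)
    (hface : ∀ T : Finset (Fin s), minface (∑ i ∈ T, x i • A i) C = atomCone A T)
    {B : ℕ → Matrix ι ι ℝ} (hB : ∀ k, Function.Injective (atomObjective A (B k))) {r : ℕ}
    (hr : r ≤ s) : ∃ X t M, IsRun C B (∑ i, x i • A i) r X t M := by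
  induction r with
  | zero =>
    exact ⟨fun _ => ∑ i, x i • A i, Fin.elim0, Fin.elim0, rfl, fun k => k.elim0⟩
  | succ r ih =>
    obtain ⟨X, t, M, h⟩ := ih (by omega)
    obtain ⟨σ, -, -, hX⟩ := h.exists_injective hA htr hx hface hB
    obtain ⟨i, hi⟩ := exists_notMem_of_lt σ (by omega)
    obtain ⟨M', t', X', h'⟩ := exists_rayStep hA htr hx hface (B r)
      (T := Finset.univ.filter fun i => ∀ k, σ k ≠ i) ⟨i, by simpa using hi⟩
    rw [← hX] at h'
    exact ⟨_, _, _, h.snoc h'⟩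

theorem algorithm_spec (hA : LinearIndependent ℝ A) (htr : ∀ i, 0 < (A i).trace)
    (hx : ∀ i, 0 < x i)
    (hface : ∀ T : Finset (Fin s), minface (∑ i ∈ T, x i • A i) C = atomCone A T)
    {B : ℕ → Matrix ι ι ℝ} (hB : ∀ k, Function.Injective (atomObjective A (B k))) :
    (∀ r X t M, IsRun C B (∑ i, x i • A i) r X t M →
      r ≤ s ∧ (X (Fin.last r) ≠ 0 → ∃ M' t' X', RayStep C (B r) (X (Fin.last r)) M' t' X')) ∧
    (∃ r t M, Returns C B (∑ i, x i • A i) r t M) ∧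
    (∀ r t M, Returns C B (∑ i, x i • A i) r t M → r = s ∧ ∃ σ : Fin r ≃ Fin s,
      ∀ k, t k = x (σ k) * (A (σ k)).trace ∧ M k = (A (σ k)).trace⁻¹ • A (σ k)) := by
  refine ⟨fun r X t M h => ?_, ?_, ?_⟩
  · obtain ⟨σ, hσ, -, hX⟩ := h.exists_injective hA htr hx hface hB
    refine ⟨by simpa using Fintype.card_le_of_injective σ hσ, fun hne => ?_⟩
    rw [hX] at hne ⊢
    exact exists_rayStep hA htr hx hface (B r)
      (Finset.nonempty_iff_ne_empty.2 fun h0 => hne (by rw [h0, Finset.sum_empty]))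
  · obtain ⟨X, t, M, h⟩ := exists_isRun hA htr hx hface hB le_rfl
    obtain ⟨σ, hσ, -, hX⟩ := h.exists_injective hA htr hx hface hB
    refine ⟨s, t, M, X, h, ?_⟩
    rw [hX]
    refine Finset.sum_eq_zero fun i hi => ?_
    obtain ⟨k, hk⟩ := Finite.surjective_of_injective hσ i
    exact absurd hk ((Finset.mem_filter.1 hi).2 k)
  · rintro r t M ⟨X, h, h0⟩
    obtain ⟨σ, hσ, htM, hX⟩ := h.exists_injective hA htr hx hface hB
    rw [h0] at hX
    -- A missed atom would survive in the final matrix with positive coefficient, and independence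
    -- forbids that this matrix is zero.
    have hsurj : Function.Surjective σ := by
      intro i
      by_contra! hi
      exact (hx i).ne' (linearIndependent_iff'.1 hA _ x hX.symm i (by simpa using hi))
    let e := Equiv.ofBijective σ ⟨hσ, hsurj⟩
    exact ⟨by simpa using Fintype.card_congr e, e, htM⟩

end Run

/-! ### Random objectives separate the atoms -/

section Random

variable {ι : Type*} [Fintype ι]

theorem measurable_trace_mul (D : Matrix ι ι ℝ) :
    Measurable fun B : Matrix ι ι ℝ => (B * D).trace := by
  have hentry : ∀ i j, Measurable fun B : Matrix ι ι ℝ => B i j := fun i j =>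
    (measurable_pi_apply j).comp (measurable_pi_apply (X := fun _ : ι => ι → ℝ) i)
  simp only [Matrix.trace, Matrix.diag_apply, Matrix.mul_apply]
  exact Finset.measurable_sum _ fun i _ => Finset.measurable_sum _ fun j _ =>
    (hentry i j).mul_const _

theorem measurable_matrix_of_sym2 {ι : Type*} :
    Measurable fun c : Sym2 ι → ℝ => (Matrix.of fun i j => c s(i, j) : Matrix ι ι ℝ) :=
  measurable_pi_lambda (X := fun _ : ι => ι → ℝ) _ fun _ => measurable_pi_lambda _ fun _ =>
    measurable_pi_apply _

/-- In the coordinates of symmetric matrices B ↦ tr(BD) is linear, and it is nonzero because at B =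
D it equals Σ D_ij². Its kernel is thus a proper subspace, of Lebesgue measure zero. -/
theorem ae_symLebesgue_trace_mul_ne_zero {D : Matrix ι ι ℝ} (hD : D.IsSymm) (hD0 : D ≠ 0) :
    ∀ᵐ B ∂symLebesgue ι, (B * D).trace ≠ 0 := by
  have hmeas : MeasurableSet {B : Matrix ι ι ℝ | (B * D).trace ≠ 0} :=
    (measurable_trace_mul D (measurableSet_singleton 0)).compl
  rw [symLebesgue, ae_map_iff measurable_matrix_of_sym2.aemeasurable hmeas]
  let φ : (Sym2 ι → ℝ) →ₗ[ℝ] ℝ :=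
    { toFun := fun c => ((Matrix.of fun i j => c s(i, j) : Matrix ι ι ℝ) * D).trace
      map_add' := fun c e => by
        simp [Matrix.trace, Matrix.mul_apply, add_mul, Finset.sum_add_distrib]
      map_smul' := fun a c => by
        simp [Matrix.trace, Matrix.mul_apply, Finset.mul_sum, mul_assoc] }
  have hφ : LinearMap.ker φ ≠ ⊤ := by
    intro h
    let c : Sym2 ι → ℝ := Sym2.lift ⟨fun i j => D i j, fun i j => (hD.apply i j).symm⟩
    have hc : φ c = 0 := LinearMap.congr_fun (LinearMap.ker_eq_top.1 h) c
    have hsq : ∑ i, ∑ j, D i j ^ 2 = 0 := by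
      rw [← hc]
      refine Finset.sum_congr rfl fun i _ => ?_
      rw [Matrix.diag_apply, Matrix.mul_apply]
      refine Finset.sum_congr rfl fun j _ => ?_
      rw [← hD.apply j i, sq]
      rw [hD.apply]
      exact congrArg (· * D j i) (hD.apply i j)
    refine hD0 (Matrix.ext fun i j => ?_)
    have h1 := (Finset.sum_eq_zero_iff_of_nonneg
      fun i _ => Finset.sum_nonneg fun j _ => sq_nonneg (D i j)).1 hsq i (Finset.mem_univ i)
    have h2 := (Finset.sum_eq_zero_iff_of_nonneg
      fun j _ => sq_nonneg (D i j)).1 h1 j (Finset.mem_univ j)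
    exact pow_eq_zero_iff two_ne_zero |>.1 h2
  have h0 : volume (LinearMap.ker φ : Set (Sym2 ι → ℝ)) = 0 :=
    Measure.addHaar_submodule volume _ hφ
  exact measure_eq_zero_iff_ae_notMem.1 h0

theorem ae_injective_atomObjective {s : ℕ} {A : Fin s → Matrix ι ι ℝ}
    (hA : LinearIndependent ℝ A) (hsymm : ∀ i, (A i).IsSymm) (htr : ∀ i, 0 < (A i).trace) :
    ∀ᵐ B ∂symLebesgue ι, Function.Injective (atomObjective A B) := by
  have h : ∀ i j, i ≠ j → ∀ᵐ B ∂symLebesgue ι, atomObjective A B i ≠ atomObjective A B j := by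
    intro i j hij
    have hD : (A i).trace⁻¹ • A i - (A j).trace⁻¹ • A j ≠ 0 := by
      intro h0
      have h1 := Fintype.linearIndependent_iff.1 hA
        (fun k => (if k = i then (A i).trace⁻¹ else 0) - if k = j then (A j).trace⁻¹ else 0)
        (by simpa [sub_smul, Finset.sum_sub_distrib, ite_smul] using h0) i
      simp [hij, (htr i).ne'] at h1
    filter_upwards [ae_symLebesgue_trace_mul_ne_zero
      (((hsymm i).smul _).sub ((hsymm j).smul _)) hD] with B hB heq
    refine hB ?_
    rw [Matrix.mul_sub, Matrix.trace_sub, Matrix.mul_smul, Matrix.mul_smul, Matrix.trace_smul,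
      Matrix.trace_smul, smul_eq_mul, smul_eq_mul, ← div_eq_inv_mul, ← div_eq_inv_mul]
    exact sub_eq_zero.2 heq
  have h' : ∀ᵐ B ∂symLebesgue ι, ∀ i j, i ≠ j → atomObjective A B i ≠ atomObjective A B j :=
    ae_all_iff.2 fun i => ae_all_iff.2 fun j => by
      by_cases hij : i = j
      · simp [hij]
      · filter_upwards [h i j hij] with B hB _ using hB
  filter_upwards [h'] with B hB i j hij
  by_contra hne
  exact hB i j hne hij

end Random

/-! ### Recovery of the point from its normalized atom -/

section Recovery

variable {n d : ℕ}

theorem trace_atomMatrix (z : Fin n → ℝ) : (atomMatrix d z).trace = momentNormSq d z := by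
  simp [atomMatrix, momentNormSq, Matrix.trace_vecMulVec, dotProduct, sq]

theorem momentNormSq_pos (z : Fin n → ℝ) : 0 < momentNormSq d z :=
  lt_of_lt_of_le (by rw [momentVec_constIndex]; norm_num)
    (Finset.single_le_sum (f := fun α => momentVec d z α ^ 2) (fun α _ => sq_nonneg _)
      (Finset.mem_univ (constIndex n d)))

theorem momentVec_ne_zero (z : Fin n → ℝ) : momentVec d z ≠ 0 := fun h => by
  simpa [h] using momentVec_constIndex (d := d) z

theorem normalizedAtom_mulVec_momentVec (z : Fin n → ℝ) :
    ((momentNormSq d z)⁻¹ • atomMatrix d z) *ᵥ momentVec d z = momentVec d z := by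
  have h : momentVec d z ⬝ᵥ momentVec d z = momentNormSq d z := by
    simp [dotProduct, momentNormSq, sq]
  rw [Matrix.smul_mulVec, atomMatrix_mulVec, h, smul_smul,
    inv_mul_cancel₀ (momentNormSq_pos z).ne', one_smul]

theorem exists_smul_momentVec_of_mulVec_eq_smul {z : Fin n → ℝ} {l : ℝ}
    {h : MultiIndex (n + 1) d → ℝ} (hl : l ≠ 0)
    (hh : ((momentNormSq d z)⁻¹ • atomMatrix d z) *ᵥ h = l • h) :
    ∃ a : ℝ, h = a • momentVec d z := by
  refine ⟨l⁻¹ * ((momentNormSq d z)⁻¹ * (h ⬝ᵥ momentVec d z)), ?_⟩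
  rw [Matrix.smul_mulVec, atomMatrix_mulVec] at hh
  rw [mul_smul, mul_smul, hh, inv_smul_smul₀ hl]

theorem rank_normalizedAtom (z : Fin n → ℝ) :
    ((momentNormSq d z)⁻¹ • atomMatrix d z).rank = 1 := by
  refine le_antisymm ?_ ?_
  · rw [atomMatrix, ← Matrix.smul_vecMulVec]
    exact Matrix.rank_vecMulVec_le _ _
  · rw [Nat.one_le_iff_ne_zero]
    intro h0
    rw [Matrix.rank, Submodule.finrank_eq_zero, LinearMap.range_eq_bot] at h0
    have h1 := normalizedAtom_mulVec_momentVec (d := d) z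
    rw [← Matrix.mulVecLin_apply, h0] at h1
    exact momentVec_ne_zero z h1.symm

theorem existsUnique_eigenvalue_normalizedAtom (z : Fin n → ℝ) :
    ∃! l : ℝ, l ≠ 0 ∧ Module.End.HasEigenvalue
      (Matrix.toLin' ((momentNormSq d z)⁻¹ • atomMatrix d z)) l := by
  refine ⟨1, ⟨one_ne_zero, Module.End.hasEigenvalue_of_hasEigenvector (x := momentVec d z)
    ⟨?_, momentVec_ne_zero z⟩⟩, ?_⟩
  · rw [Module.End.mem_eigenspace_iff, Matrix.toLin'_apply, normalizedAtom_mulVec_momentVec,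
      one_smul]
  · rintro l ⟨hl, hev⟩
    obtain ⟨v, hv⟩ := hev.exists_hasEigenvector
    have h1 := hv.apply_eq_smul
    rw [Matrix.toLin'_apply] at h1
    obtain ⟨a, rfl⟩ := exists_smul_momentVec_of_mulVec_eq_smul hl h1
    rw [Matrix.mulVec_smul, normalizedAtom_mulVec_momentVec] at h1
    have h2 : (l - 1) • a • momentVec d z = 0 := by rw [sub_smul, one_smul, ← h1, sub_self]
    exact sub_eq_zero.1 ((smul_eq_zero.1 h2).resolve_right hv.2)

/-- An eigenvector is h = a m_d(z), so its first entry is a; unit norm gives a²‖m_d(z)‖² = 1. The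
unknown sign of a cancels in the quotients and in the square. -/
theorem recovery_normalizedAtom (hd : 0 < d) (z : Fin n → ℝ) {w l : ℝ}
    {h : MultiIndex (n + 1) d → ℝ} (hl : l ≠ 0)
    (hh : ((momentNormSq d z)⁻¹ • atomMatrix d z) *ᵥ h = l • h) (hnorm : ∑ α, h α ^ 2 = 1) :
    h (constIndex n d) ≠ 0 ∧ momentVec d z = (h (constIndex n d))⁻¹ • h ∧
      (∀ j : Fin n, z j = h (linIndex hd j) / h (constIndex n d)) ∧
      w ^ 2 = w ^ 2 * momentNormSq d z * h (constIndex n d) ^ 2 := by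
  obtain ⟨a, rfl⟩ := exists_smul_momentVec_of_mulVec_eq_smul hl hh
  have hnorm' : a ^ 2 * momentNormSq d z = 1 := by
    rw [← hnorm, momentNormSq, Finset.mul_sum]
    simp [mul_pow]
  have ha : a ≠ 0 := by
    rintro rfl
    norm_num at hnorm'
  simp only [Pi.smul_apply, momentVec_constIndex, momentVec_linIndex, smul_eq_mul, mul_one]
  refine ⟨ha, (inv_smul_smul₀ ha _).symm, fun j => (mul_div_cancel_left₀ _ ha).symm, ?_⟩
  rw [mul_assoc, mul_comm (momentNormSq d z), hnorm', mul_one]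

end Recovery

/-! ### Genericity -/

section Genericity

variable {n s : ℕ}

theorem exists_paramCoords_eq (c : Fin s × Option (Fin n) → ℝ) :
    ∃ p : Fin s → ℝ × (Fin n → ℝ), paramCoords p = c := by
  refine ⟨fun i => (c (i, none), fun j => c (i, some j)), funext fun ⟨i, o⟩ => ?_⟩
  cases o <;> rfl

theorem holdsGenerically_of_eval_ne_zero {P : (Fin s → ℝ × (Fin n → ℝ)) → Prop}
    {f : MvPolynomial (Fin s × Option (Fin n)) ℝ} (hf : f ≠ 0)
    (hP : ∀ p, MvPolynomial.eval (paramCoords p) f ≠ 0 → P p) : HoldsGenerically P := by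
  refine ⟨{p | MvPolynomial.eval (paramCoords p) f ≠ 0}, ⟨{f}, ?_⟩, ?_, hP⟩
  · ext p
    simp
  · rintro _ ⟨F, rfl⟩ hsub
    refine Set.eq_univ_of_forall fun p g hg => ?_
    -- A polynomial g vanishing wherever f does not makes g f vanish at every real point, and the
    -- polynomial ring is a domain.
    have h0 : g * f = 0 := by
      refine MvPolynomial.funext fun c => ?_
      obtain ⟨q, rfl⟩ := exists_paramCoords_eq c
      rw [map_mul, map_zero]
      by_cases hq : MvPolynomial.eval (paramCoords q) f = 0
      · rw [hq, mul_zero]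
      · rw [hsub hq g hg, zero_mul]
    rw [(mul_eq_zero.1 h0).resolve_right hf, map_zero]

theorem exists_polynomial_general_position {d : ℕ}
    (hbound : 2 * (s * (n + d).choose d + (n + 2 * d).choose (2 * d)) ≤
      (n + d).choose d * ((n + d).choose d + 1)) :
    ∃ f : MvPolynomial (Fin s × Option (Fin n)) ℝ, f ≠ 0 ∧
      ∀ p : Fin s → ℝ × (Fin n → ℝ), MvPolynomial.eval (paramCoords p) f ≠ 0 →
        (∀ i, (p i).1 ≠ 0) ∧
          ∀ a b, a ≠ b → ∃ S, SeparatesPair d (fun i => (p i).2) a b S := by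
  classical
  have h : ∀ q : Fin s × Fin s, ∃ f : MvPolynomial (Fin s × Option (Fin n)) ℝ, f ≠ 0 ∧
      ∀ p : Fin s → ℝ × (Fin n → ℝ), MvPolynomial.eval (paramCoords p) f ≠ 0 →
        q.1 ≠ q.2 → ∃ S, SeparatesPair d (fun i => (p i).2) q.1 q.2 S := by
    intro q
    by_cases hq : q.1 = q.2
    · exact ⟨1, one_ne_zero, fun _ _ h => absurd hq h⟩
    · obtain ⟨f, hf, hfS⟩ := exists_polynomial_separatesPair hq hbound
      exact ⟨f, hf, fun p hp _ => hfS p hp⟩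
  choose f hf hfS using h
  -- The first product keeps all weights nonzero, the second makes every ordered pair separable.
  refine ⟨(∏ i, MvPolynomial.X (i, none)) * ∏ q, f q, mul_ne_zero
    (Finset.prod_ne_zero_iff.2 fun i _ => MvPolynomial.X_ne_zero _)
    (Finset.prod_ne_zero_iff.2 fun q _ => hf q), fun p hp => ?_⟩
  rw [map_mul, map_prod, map_prod, mul_ne_zero_iff, Finset.prod_ne_zero_iff,
    Finset.prod_ne_zero_iff] at hp
  refine ⟨fun i => ?_, fun a b hab => hfS (a, b) p (hp.2 (a, b) (Finset.mem_univ _)) hab⟩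
  simpa [paramCoords] using hp.1 i (Finset.mem_univ i)

end Genericity

end PseudoMoment

theorem corollary1 (n d s : ℕ) (hn : 1 ≤ n) (hd : 2 ≤ d) (hs : 1 ≤ s)
    (hbound : (s : ℝ) ≤ (1 / 2) * (((n + d).choose d : ℝ) + 1)
      - ((n + d).choose d : ℝ)⁻¹ * ((n + 2 * d).choose (2 * d) : ℝ)) :
    HoldsGenerically (n := n) (s := s) fun p =>
      ∀ (Ω : Type*) [MeasurableSpace Ω] (μ : Measure Ω) [IsProbabilityMeasure μ]
        (B : ℕ → Ω → Matrix (MultiIndex (n + 1) d) (MultiIndex (n + 1) d) ℝ),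
        (∀ k, Measurable (B k)) →
        (∀ k, μ.map (B k) ≪ symLebesgue (MultiIndex (n + 1) d)) →
        ∀ᵐ ω ∂μ,
          -- no execution gets stuck before it returns, and none exceeds `s` iterations
          (∀ r X t M, IsRun (pseudoMomentCone (n + 1) d) (fun k => B k ω)
              (∑ i, (p i).1 ^ 2 • atomMatrix d (p i).2) r X t M →
            r ≤ s ∧ (X (Fin.last r) ≠ 0 → ∃ M' t' X',
              RayStep (pseudoMomentCone (n + 1) d) (B r ω) (X (Fin.last r)) M' t' X')) ∧
          (∃ r t M, Returns (pseudoMomentCone (n + 1) d) (fun k => B k ω)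
              (∑ i, (p i).1 ^ 2 • atomMatrix d (p i).2) r t M) ∧
          -- every output is the planted decomposition up to order, and the recovery is correct
          (∀ r t M, Returns (pseudoMomentCone (n + 1) d) (fun k => B k ω)
              (∑ i, (p i).1 ^ 2 • atomMatrix d (p i).2) r t M →
            r = s ∧ ∃ σ : Fin r ≃ Fin s, ∀ k : Fin r,
              t k = (p (σ k)).1 ^ 2 * momentNormSq d (p (σ k)).2 ∧
              M k = (momentNormSq d (p (σ k)).2)⁻¹ • atomMatrix d (p (σ k)).2 ∧
              (M k).rank = 1 ∧
              (∃! l : ℝ, l ≠ 0 ∧ Module.End.HasEigenvalue (Matrix.toLin' (M k)) l) ∧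
              ∀ (l : ℝ) (h : MultiIndex (n + 1) d → ℝ), l ≠ 0 → M k *ᵥ h = l • h →
                ∑ α, h α ^ 2 = 1 →
                h (constIndex n d) ≠ 0 ∧
                momentVec d (p (σ k)).2 = (h (constIndex n d))⁻¹ • h ∧
                (∀ j : Fin n, (p (σ k)).2 j =
                  h (linIndex (Nat.zero_lt_of_lt hd) j) / h (constIndex n d)) ∧
                (p (σ k)).1 ^ 2 = t k * h (constIndex n d) ^ 2) := by
  have hN : (0 : ℝ) < ((n + d).choose d : ℝ) := by
    exact_mod_cast Nat.choose_pos (Nat.le_add_left d n)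
  -- Multiplying the bound by 2N clears the denominators and gives the integer inequality used in
  -- the count.
  have hbound' : 2 * (s * (n + d).choose d + (n + 2 * d).choose (2 * d)) ≤
      (n + d).choose d * ((n + d).choose d + 1) := by
    have h := mul_le_mul_of_nonneg_right hbound hN.le
    have h' : ((n + d).choose d : ℝ)⁻¹ * ((n + 2 * d).choose (2 * d) : ℝ) * ((n + d).choose d : ℝ)
        = ((n + 2 * d).choose (2 * d) : ℝ) := by
      rw [mul_right_comm, inv_mul_cancel₀ hN.ne', one_mul]
    rw [sub_mul, h'] at h
    have h2 : (2 : ℝ) * (s * (n + d).choose d + (n + 2 * d).choose (2 * d)) ≤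
      (n + d).choose d * ((n + d).choose d + 1) := by linarith
    exact_mod_cast h2
  obtain ⟨f, hf, hfp⟩ := exists_polynomial_general_position (n := n) (s := s) hbound'
  refine holdsGenerically_of_eval_ne_zero hf fun p hp Ω _ μ _ B hBm hBac => ?_
  obtain ⟨hw, hsep⟩ := hfp p hp
  have hA := linearIndependent_atomMatrix hsep
  have htr : ∀ i, 0 < (atomMatrix d (p i).2).trace := fun i => by
    rw [trace_atomMatrix]
    exact momentNormSq_pos _
  have hx : ∀ i, 0 < (p i).1 ^ 2 := fun i => sq_pos_of_ne_zero (hw i)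
  -- Countably many almost sure events are intersected, so only the law of each single draw enters.
  have hinj : ∀ᵐ ω ∂μ, ∀ k,
      Function.Injective (atomObjective (fun i => atomMatrix d (p i).2) (B k ω)) :=
    ae_all_iff.2 fun k => ae_of_ae_map (hBm k).aemeasurable ((hBac k).ae_le
      (ae_injective_atomObjective hA
        (fun i => Matrix.IsSymm.ext fun α β => mul_comm _ _) htr))
  filter_upwards [hinj] with ω hω
  obtain ⟨h1, h2, h3⟩ := algorithm_spec hA htr hx
    (fun T => minface_sum_atomMatrix hsep T hx) (B := fun k => B k ω) hω
  refine ⟨h1, h2, fun r t M hret => ?_⟩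
  obtain ⟨hr, σ, hσ⟩ := h3 r t M hret
  refine ⟨hr, σ, fun k => ?_⟩
  obtain ⟨ht, hM⟩ := hσ k
  rw [trace_atomMatrix] at ht hM
  rw [ht, hM]
  exact ⟨rfl, rfl, rank_normalizedAtom _, existsUnique_eigenvalue_normalizedAtom _,
    fun l h hl hh hnorm => recovery_normalizedAtom _ _ hl hh hnorm⟩
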